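/- Let $\mathbb{F}$ be a finite field and let $m,n,p,q$ be positive integers. Two matrices $A,B$ of the same size over $\mathbb{F}$ are called adjacent if $\operatorname{rank}(A-B)=1$, and a set of matrices is called adjacent if any two distinct elements of it are adjacent. A map $\phi : M_{m\times n}(\mathbb{F}) \to M_{p\times q}(\mathbb{F})$ preserves adjacency if $\phi(A)$ and $\phi(B)$ are adjacent whenever $A,B\in M_{m\times n}(\mathbb{F})$ are adjacent. An adjacency preserving map $\phi$ is called degenerate if for every $A \in M_{m\times n}(\mathbb{F})$ there exist a nonzero column $x \in M_{p\times 1}(\mathbb{F})$ and a nonzero row $y \in M_{1\times q}(\mathbb{F})$ such that $$\phi\bigl(\{B \in M_{m\times n}(\mathbb{F}) : \operatorname{rank}(A-B)\le 1\}\bigr) \subset \{\phi(A)+vy : v\in M_{p\times 1}(\mathbb{F})\} \cup \{\phi(A)+xu : u\in M_{1\times q}(\mathbb{F})\}.$$ If $\phi : M_{m\times n}(\mathbb{F}) \to M_{p\times q}(\mathbb{F})$ is a degenerate adjacency preserving map, then the range of $\phi$ is an adjacent set; that is, $\operatorname{rank}(\phi(A)-\phi(B))=1$ for all $A,B\in M_{m\times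 n}(\mathbb{F})$ with $\phi(A)\neq\phi(B)$. -/

import Mathlib

namespace MatrixGeometry

variable {F : Type*} [Field F] {m n p q : ℕ}

/-- Two matrices are adjacent if their difference has rank one. -/
def Adjacent (A B : Matrix (Fin m) (Fin n) F) : Prop :=
  (A - B).rank = 1

/-- A set of matrices is adjacent if any two distinct members of it are adjacent. -/
def IsAdjacentSet (S : Set (Matrix (Fin m) (Fin n) F)) : Prop :=
  ∀ A ∈ S, ∀ B ∈ S, A ≠ B → Adjacent A B

/-- `φ` preserves adjacency (in one direction). -/
def PreservesAdjacency (φ : Matrix (Fin m) (Fin n) F → Matrix (Fin p) (Fin q) F) : Prop :=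
  ∀ A B, Adjacent A B → Adjacent (φ A) (φ B)

/-- The ball of radius one around `A` for the arithmetic distance `rank (A - B)`. -/
def unitBall (A : Matrix (Fin m) (Fin n) F) : Set (Matrix (Fin m) (Fin n) F) :=
  {B | (A - B).rank ≤ 1}

/-- The set `R(y)` of all products `v y` (column times row), with the row `y` fixed. -/
def rightSet (p : ℕ) (y : Fin q → F) : Set (Matrix (Fin p) (Fin q) F) :=
  {M | ∃ v : Fin p → F, M = Matrix.vecMulVec v y}

/-- The set `L(x)` of all products `x u` (column times row), with the column `x` fixed. -/
def leftSet (q : ℕ) (x : Fin p → F) : Set (Matrix (Fin p) (Fin q) F) :=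
  {M | ∃ u : Fin q → F, M = Matrix.vecMulVec x u}

/-- `φ` is degenerate with respect to `A`: it maps the unit ball around `A` into
`(φ A + R(y)) ∪ (φ A + L(x))` for some nonzero column `x` and nonzero row `y`. -/
def IsDegenerateAt (φ : Matrix (Fin m) (Fin n) F → Matrix (Fin p) (Fin q) F)
    (A : Matrix (Fin m) (Fin n) F) : Prop :=
  ∃ x : Fin p → F, ∃ y : Fin q → F, x ≠ 0 ∧ y ≠ 0 ∧
    φ '' unitBall A ⊆
      ((fun M => φ A + M) '' rightSet p y) ∪ ((fun M => φ A + M) '' leftSet q x)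

/-- A degenerate adjacency preserver: an adjacency preserving map which is degenerate with
respect to every matrix of its domain. -/
def IsDegenerateAdjacencyPreserver
    (φ : Matrix (Fin m) (Fin n) F → Matrix (Fin p) (Fin q) F) : Prop :=
  PreservesAdjacency φ ∧ ∀ A, IsDegenerateAt φ A

end MatrixGeometry

/-!
For `n = 1` any two distinct matrices of the domain are adjacent, so let `n ≥ 2`. Fix `A` and
suppose `φ` maps the unit ball around `A` into `(φ A + R(y)) ∪ (φ A + L(x))`. The ball is the union
of the row cliques `A + L(a)` and also of the column cliques `A + R(w)`, and `φ` maps each of these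
into one of the two parts. If the ball is not mapped into a single part, then some row clique is
mapped into the left part and another one into the right part. Among the column cliques given by
the pairwise independent rows `e`, `f`, `e + f`, two go to the same part, so together with one of
the two row cliques they provide two lines of a clique that are mapped into the line
`φ A + (R(y) ∩ L(x))`. As `φ` is injective on cliques, this is impossible over a finite field. So
each ball is mapped into a single part. The same count shows that balls around adjacent matrices
are mapped into parts of the same kind, in fact with the same `y` (or `x`). Since any two matrices
are joined by a chain of adjacent ones, the whole range lies in one translate of `R(y)` (or `L(x)`).
-/

namespace MatrixGeometry

open Matrix

section LinearAlgebra

variable {K V W ι κ : Type*} [Field K] [AddCommGroup V] [Module K V] [AddCommMonoid W] [Module K W]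

theorem not_linearIndependent_pair_of_mapsTo_span_singleton [Finite K] {g : V → W}
    (hg : Function.Injective g) {t : W} {v w : V} (hv : ∀ c : K, g (c • v) ∈ K ∙ t)
    (hw : ∀ c : K, g (c • w) ∈ K ∙ t) : ¬ LinearIndependent K ![v, w] := by
  intro hvw
  obtain ⟨d, hd⟩ := Submodule.mem_span_singleton.mp (hv 1)
  choose f hf using fun c => Submodule.mem_span_singleton.mp (hw c)
  have hw0 : w ≠ 0 := hvw.ne_zero 1
  have hf_inj : Function.Injective f := fun b c hbc =>
    smul_left_injective K hw0 (hg ((hf b).symm.trans (hbc ▸ hf c)))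
  obtain ⟨c, rfl⟩ := Finite.surjective_of_injective hf_inj d
  have hcw : c • w = (1 : K) • v := hg ((hf c).symm.trans hd)
  exact (LinearIndependent.pair_iff' hw0).mp (LinearIndependent.pair_symm_iff.mp hvw) c
    (hcw.trans (one_smul K v))

theorem exists_linearIndependent_pair_of_forall_or (hV : 1 < Module.finrank K V) {P Q : V → Prop}
    (h : ∀ v, P v ∨ Q v) :
    ∃ v w, LinearIndependent K ![v, w] ∧ (P v ∧ P w ∨ Q v ∧ Q w) := by
  have : FiniteDimensional K V := Module.finite_of_finrank_pos (by omega)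
  have : Nontrivial V := Module.nontrivial_of_finrank_pos (R := K) (by omega)
  obtain ⟨e, he⟩ := exists_ne (0 : V)
  obtain ⟨f, hef⟩ := exists_linearIndependent_pair_of_one_lt_finrank hV he
  have he_add : LinearIndependent K ![e, e + f] := by simpa using hef
  have hadd_f : LinearIndependent K ![e + f, f] := by simpa using hef
  grind

-- `Matrix.vecMulVec_zero` is restricted to vectors with the same index type.
theorem vecMulVec_zero_right {R : Type*} [MulZeroClass R] (a : ι → R) :
    vecMulVec a (0 : κ → R) = 0 :=
  Matrix.ext fun i _ => mul_zero (a i)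

theorem vecMulVec_injective_of_ne_zero {R : Type*} [Mul R] [Zero R] [IsLeftCancelMulZero R]
    {a : ι → R} (ha : a ≠ 0) : Function.Injective (vecMulVec a : (κ → R) → Matrix ι κ R) := by
  obtain ⟨i, hi⟩ := Function.ne_iff.mp ha
  exact fun u u' h => funext fun j => mul_left_cancel₀ hi (congrFun₂ h i j)

variable [Fintype κ]

theorem rank_eq_zero_iff {M : Matrix ι κ K} : M.rank = 0 ↔ M = 0 := by
  classical
  rw [Matrix.rank, Submodule.finrank_eq_zero, LinearMap.range_eq_bot, ← Matrix.toLin'_apply',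
    LinearEquiv.map_eq_zero_iff]

theorem rank_le_one_iff {M : Matrix ι κ K} : M.rank ≤ 1 ↔ ∃ a b, M = vecMulVec a b := by
  classical
  refine ⟨fun h => ?_, fun ⟨a, b, hab⟩ => hab ▸ rank_vecMulVec_le a b⟩
  obtain ⟨a, ha⟩ := finrank_le_one_iff.mp h
  choose b hb using fun j : κ => ha ⟨M *ᵥ Pi.single j 1, _, rfl⟩
  refine ⟨a, b, Matrix.ext fun i j => ?_⟩
  have hcol : b j • (a : ι → K) = M.col j := by simpa using congrArg Subtype.val (hb j)
  rw [vecMulVec_apply, mul_comm]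
  exact (congrFun hcol i).symm

end LinearAlgebra

section

variable {F : Type*} [Field F] {m n p q : ℕ} {x : Fin p → F} {y : Fin q → F}
  {A B : Matrix (Fin m) (Fin n) F} {φ : Matrix (Fin m) (Fin n) F → Matrix (Fin p) (Fin q) F}

theorem mem_unitBall_iff_exists : B ∈ unitBall A ↔ ∃ a b, B = A + vecMulVec a b := by
  rw [unitBall, Set.mem_ofPred_eq, rank_le_one_iff]
  constructor
  · rintro ⟨a, b, h⟩
    exact ⟨-a, b, by rw [neg_vecMulVec, ← h]; abel⟩
  · rintro ⟨a, b, rfl⟩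
    exact ⟨-a, b, by rw [neg_vecMulVec]; abel⟩

theorem mem_unitBall_comm : B ∈ unitBall A ↔ A ∈ unitBall B := by
  suffices h : ∀ A B : Matrix (Fin m) (Fin n) F, B ∈ unitBall A → A ∈ unitBall B from
    ⟨h A B, h B A⟩
  intro A B h
  obtain ⟨a, b, rfl⟩ := mem_unitBall_iff_exists.mp h
  exact mem_unitBall_iff_exists.mpr ⟨-a, b, by rw [neg_vecMulVec]; abel⟩

theorem adjacent_iff_ne_and_mem_unitBall : Adjacent A B ↔ A ≠ B ∧ B ∈ unitBall A := by
  rw [Adjacent, unitBall, Set.mem_ofPred_eq, ← sub_ne_zero, Ne, ← rank_eq_zero_iff]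
  omega

theorem adjacent_transpose_iff : Adjacent Aᵀ Bᵀ ↔ Adjacent A B := by
  rw [Adjacent, Adjacent, ← transpose_sub, rank_transpose]

theorem forall_of_unitBall {P : Matrix (Fin m) (Fin n) F → Prop}
    (hP : ∀ A, P A → ∀ B ∈ unitBall A, P B) (hA : P A) (B : Matrix (Fin m) (Fin n) F) : P B := by
  suffices h : ∀ M A, P A → P (A + M) by simpa using h (B - A) A hA
  intro M
  induction M using Matrix.induction_on' with
  | h_zero => simp
  | h_add M N hM hN => exact fun A hA => add_assoc A M N ▸ hN _ (hM A hA)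
  | h_std_basis i j c =>
    refine fun A hA => hP A hA _ (mem_unitBall_iff_exists.mpr
      ⟨c • Pi.single i 1, Pi.single j 1, ?_⟩)
    rw [smul_vecMulVec, ← single_eq_single_vecMulVec_single, smul_single, smul_eq_mul, mul_one]

/-- The set `R(y)` as a linear subspace. -/
def rightSubmodule (p : ℕ) (y : Fin q → F) : Submodule F (Matrix (Fin p) (Fin q) F) where
  carrier := rightSet p y
  add_mem' := by
    rintro _ _ ⟨v, rfl⟩ ⟨w, rfl⟩
    exact ⟨v + w, (add_vecMulVec v w y).symm⟩
  zero_mem' := ⟨0, (zero_vecMulVec y).symm⟩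
  smul_mem' := by
    rintro c _ ⟨v, rfl⟩
    exact ⟨c • v, (smul_vecMulVec c v y).symm⟩

theorem transpose_mem_rightSet_iff {M : Matrix (Fin p) (Fin q) F} :
    Mᵀ ∈ rightSet q x ↔ M ∈ leftSet q x := by
  refine exists_congr fun u => ?_
  rw [← transpose_vecMulVec, transpose_inj]

theorem transpose_mem_leftSet_iff {M : Matrix (Fin p) (Fin q) F} :
    Mᵀ ∈ leftSet p y ↔ M ∈ rightSet p y := by
  rw [← transpose_mem_rightSet_iff, transpose_transpose]

theorem rightSet_inter_leftSet_subset :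
    rightSet p y ∩ leftSet q x ⊆ F ∙ vecMulVec x y := by
  rintro _ ⟨⟨v, rfl⟩, u, hu⟩
  rcases eq_or_ne y 0 with rfl | hy
  · simp [vecMulVec_zero_right]
  obtain ⟨j, hj : y j ≠ 0⟩ := Function.ne_iff.mp hy
  have hv : v = (u j / y j) • x := by
    ext i
    have hij : v i * y j = x i * u j := congrFun₂ hu i j
    simp only [Pi.smul_apply, smul_eq_mul]
    field_simp
    linear_combination hij
  exact Submodule.mem_span_singleton.mpr ⟨u j / y j, by rw [hv, smul_vecMulVec]⟩

theorem rightSet_subset_rightSet_of_mem {M : Matrix (Fin p) (Fin q) F} {y' : Fin q → F}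
    (hM : M ≠ 0) (hy : M ∈ rightSet p y) (hy' : M ∈ rightSet p y') :
    rightSet p y' ⊆ rightSet p y := by
  obtain ⟨v, hv⟩ := hy
  obtain ⟨w, rfl⟩ := hy'
  have hw : w ≠ 0 := by
    rintro rfl
    exact hM (zero_vecMulVec y')
  obtain ⟨i, hi : w i ≠ 0⟩ := Function.ne_iff.mp hw
  have hy' : y' = (v i / w i) • y := by
    ext j
    have hij : w i * y' j = v i * y j := congrFun₂ hv i j
    simp only [Pi.smul_apply, smul_eq_mul]
    field_simp
    linear_combination hij
  rintro _ ⟨u, rfl⟩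
  exact ⟨(v i / w i) • u, by rw [hy', vecMulVec_smul, smul_vecMulVec]⟩

theorem mem_leftSet_or_mem_rightSet_of_rank_sub_le_one {M N : Matrix (Fin p) (Fin q) F}
    (hM : M ∈ leftSet q x) (hN : N ∈ rightSet p y) (h : (N - M).rank ≤ 1) :
    N ∈ leftSet q x ∨ M ∈ rightSet p y := by
  refine or_iff_not_imp_right.mpr fun hMy => ?_
  obtain ⟨u, rfl⟩ := hM
  obtain ⟨v, rfl⟩ := hN
  obtain ⟨a, b, hab⟩ := rank_le_one_iff.mp h
  have hu : u ∉ F ∙ y := by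
    intro hu
    obtain ⟨c, rfl⟩ := Submodule.mem_span_singleton.mp hu
    exact hMy ⟨c • x, by rw [vecMulVec_smul, smul_vecMulVec]⟩
  -- A functional killing `y` but not `u`, applied to the rows, shows that `x` is parallel to `a`.
  obtain ⟨f, hfu, hf⟩ := Submodule.exists_le_ker_of_notMem hu
  have hfy : f y = 0 := hf (Submodule.mem_span_singleton_self y)
  have hrow (i) : -(x i * f u) = a i * f b := by
    have hi : v i • y - x i • u = a i • b := congrFun hab i
    simpa [hfy] using congrArg f hi
  have hfb : f b ≠ 0 := by
    intro hfb
    have hx : x = 0 := funext fun i => by simpa [hfb, hfu] using hrow i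
    exact hMy ⟨0, by rw [hx, zero_vecMulVec, zero_vecMulVec]⟩
  have ha : a = -(f u / f b) • x := by
    ext i
    simp only [Pi.smul_apply, smul_eq_mul]
    field_simp
    linear_combination -hrow i
  refine ⟨u - (f u / f b) • b, ?_⟩
  rw [← sub_add_cancel (vecMulVec v y) (vecMulVec x u), hab, ha, vecMulVec_sub, vecMulVec_smul,
    smul_vecMulVec, neg_smul]
  abel

theorem isAdjacentSet_range_add_vecMulVec_right (A : Matrix (Fin m) (Fin n) F) (a : Fin m → F) :
    IsAdjacentSet (Set.range fun u => A + vecMulVec a u) := by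
  rintro _ ⟨u, rfl⟩ _ ⟨u', rfl⟩ hne
  refine adjacent_iff_ne_and_mem_unitBall.mpr ⟨hne, mem_unitBall_iff_exists.mpr ⟨a, u' - u, ?_⟩⟩
  simp only [vecMulVec_sub]
  abel

theorem isAdjacentSet_range_add_vecMulVec_left (A : Matrix (Fin m) (Fin n) F) (b : Fin n → F) :
    IsAdjacentSet (Set.range fun v => A + vecMulVec v b) := by
  rintro _ ⟨v, rfl⟩ _ ⟨v', rfl⟩ hne
  refine adjacent_iff_ne_and_mem_unitBall.mpr ⟨hne, mem_unitBall_iff_exists.mpr ⟨v' - v, b, ?_⟩⟩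
  simp only [sub_vecMulVec]
  abel

theorem PreservesAdjacency.injective_add_vecMulVec (hφ : PreservesAdjacency φ)
    (A : Matrix (Fin m) (Fin n) F) {a : Fin m → F} (ha : a ≠ 0) :
    Function.Injective fun u => φ (A + vecMulVec a u) := by
  intro u u' h
  by_contra hne
  have hne' : A + vecMulVec a u ≠ A + vecMulVec a u' :=
    (add_right_injective A).ne ((vecMulVec_injective_of_ne_zero ha).ne hne)
  have hadj := isAdjacentSet_range_add_vecMulVec_right A a _ ⟨u, rfl⟩ _ ⟨u', rfl⟩ hne'
  exact (adjacent_iff_ne_and_mem_unitBall.mp (hφ _ _ hadj)).1 h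

theorem PreservesAdjacency.mapsTo_right_or_left (hφ : PreservesAdjacency φ)
    {S : Set (Matrix (Fin m) (Fin n) F)} (hS : IsAdjacentSet S) {C : Matrix (Fin p) (Fin q) F}
    (h : ∀ B ∈ S, φ B - C ∈ rightSet p y ∪ leftSet q x) :
    (∀ B ∈ S, φ B - C ∈ rightSet p y) ∨ ∀ B ∈ S, φ B - C ∈ leftSet q x := by
  by_contra! ⟨⟨M, hMS, hMy⟩, N, hNS, hNx⟩
  have hMx := (h M hMS).resolve_left hMy
  have hNy := (h N hNS).resolve_right hNx
  have hne : N ≠ M := fun hNM => hMy (hNM ▸ hNy)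
  have hrank : (φ N - C - (φ M - C)).rank ≤ 1 := by
    rw [sub_sub_sub_cancel_right]
    exact (hφ N M (hS N hNS M hMS hne)).le
  exact (mem_leftSet_or_mem_rightSet_of_rank_sub_le_one hMx hNy hrank).elim hNx hMy

/-- `φ` maps the unit ball around `A` into `φ A + S`. For `S = R(y) ∪ L(x)` this is degeneracy with
respect to `A`; the point is to replace `S` by one of `R(y)` and `L(x)`. -/
def MapsBallInto (φ : Matrix (Fin m) (Fin n) F → Matrix (Fin p) (Fin q) F)
    (A : Matrix (Fin m) (Fin n) F) (S : Set (Matrix (Fin p) (Fin q) F)) : Prop :=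
  ∀ B ∈ unitBall A, φ B - φ A ∈ S

theorem IsDegenerateAt.exists_mapsBallInto (h : IsDegenerateAt φ A) :
    ∃ x y, MapsBallInto φ A (rightSet p y ∪ leftSet q x) := by
  obtain ⟨x, y, -, -, hxy⟩ := h
  refine ⟨x, y, fun B hB => ?_⟩
  rw [← Set.image_union] at hxy
  obtain ⟨M, hM, hMB⟩ := hxy ⟨B, hB, rfl⟩
  rwa [← hMB, add_sub_cancel_left]

theorem MapsBallInto.row_right_or_left (h : MapsBallInto φ A (rightSet p y ∪ leftSet q x))
    (hφ : PreservesAdjacency φ) (a : Fin m → F) :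
    (∀ u, φ (A + vecMulVec a u) - φ A ∈ rightSet p y) ∨
      ∀ u, φ (A + vecMulVec a u) - φ A ∈ leftSet q x := by
  simpa only [Set.forall_mem_range] using
    hφ.mapsTo_right_or_left (isAdjacentSet_range_add_vecMulVec_right A a)
      (Set.forall_mem_range.mpr fun u => h _ (mem_unitBall_iff_exists.mpr ⟨a, u, rfl⟩))

theorem MapsBallInto.column_right_or_left (h : MapsBallInto φ A (rightSet p y ∪ leftSet q x))
    (hφ : PreservesAdjacency φ) (b : Fin n → F) :
    (∀ v, φ (A + vecMulVec v b) - φ A ∈ rightSet p y) ∨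
      ∀ v, φ (A + vecMulVec v b) - φ A ∈ leftSet q x := by
  simpa only [Set.forall_mem_range] using
    hφ.mapsTo_right_or_left (isAdjacentSet_range_add_vecMulVec_left A b)
      (Set.forall_mem_range.mpr fun v => h _ (mem_unitBall_iff_exists.mpr ⟨v, b, rfl⟩))

theorem PreservesAdjacency.not_linearIndependent_pair [Finite F] (hφ : PreservesAdjacency φ)
    {C : Matrix (Fin p) (Fin q) F} {a : Fin m → F} (ha : a ≠ 0) {v w : Fin n → F}
    (hv : ∀ c : F, φ (A + vecMulVec a (c • v)) - C ∈ rightSet p y ∩ leftSet q x)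
    (hw : ∀ c : F, φ (A + vecMulVec a (c • w)) - C ∈ rightSet p y ∩ leftSet q x) :
    ¬ LinearIndependent F ![v, w] :=
  not_linearIndependent_pair_of_mapsTo_span_singleton
    (g := fun u => φ (A + vecMulVec a u) - C)
    (sub_left_injective.comp (hφ.injective_add_vecMulVec A ha))
    (fun c => rightSet_inter_leftSet_subset (hv c)) fun c => rightSet_inter_leftSet_subset (hw c)

theorem exists_row_of_not_mapsBallInto {S : Set (Matrix (Fin p) (Fin q) F)} (hS : 0 ∈ S)
    (h : ¬ MapsBallInto φ A S) :
    ∃ a ≠ 0, ¬ ∀ u, φ (A + vecMulVec a u) - φ A ∈ S := by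
  simp only [MapsBallInto, not_forall] at h
  obtain ⟨B, hB, hBS⟩ := h
  obtain ⟨a, b, rfl⟩ := mem_unitBall_iff_exists.mp hB
  refine ⟨a, ?_, fun h => hBS (h b)⟩
  rintro rfl
  exact hBS (by simpa using hS)

theorem MapsBallInto.right_or_left [Finite F] (hn : 1 < n) (hφ : PreservesAdjacency φ)
    (h : MapsBallInto φ A (rightSet p y ∪ leftSet q x)) :
    MapsBallInto φ A (rightSet p y) ∨ MapsBallInto φ A (leftSet q x) := by
  by_contra! ⟨hR, hL⟩
  obtain ⟨a, ha, haR⟩ := exists_row_of_not_mapsBallInto (rightSubmodule p y).zero_mem hR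
  obtain ⟨a', ha', haL⟩ := exists_row_of_not_mapsBallInto
    (S := leftSet q x) ⟨0, (vecMulVec_zero_right x).symm⟩ hL
  have hrowL := (h.row_right_or_left hφ a).resolve_left haR
  have hrowR := (h.row_right_or_left hφ a').resolve_right haL
  have hcol {a : Fin m → F} {S : Set (Matrix (Fin p) (Fin q) F)} {b : Fin n → F}
      (hb : ∀ v, φ (A + vecMulVec v b) - φ A ∈ S) (c : F) :
      φ (A + vecMulVec a (c • b)) - φ A ∈ S := by
    rw [vecMulVec_smul, ← smul_vecMulVec]
    exact hb _
  obtain ⟨v, w, hvw, ⟨hv, hw⟩ | ⟨hv, hw⟩⟩ := exists_linearIndependent_pair_of_forall_or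
    (K := F) (by simpa using hn) (h.column_right_or_left hφ)
  · exact hφ.not_linearIndependent_pair ha (fun c => ⟨hcol hv c, hrowL _⟩)
      (fun c => ⟨hcol hw c, hrowL _⟩) hvw
  · exact hφ.not_linearIndependent_pair ha' (fun c => ⟨hrowR _, hcol hv c⟩)
      (fun c => ⟨hrowR _, hcol hw c⟩) hvw

theorem MapsBallInto.not_left_of_adjacent [Finite F] (hn : 1 < n) (hφ : PreservesAdjacency φ)
    (hA : MapsBallInto φ A (rightSet p y)) (hAB : Adjacent A B) :
    ¬ MapsBallInto φ B (leftSet q x) := by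
  intro hB
  obtain ⟨hne, hBA⟩ := adjacent_iff_ne_and_mem_unitBall.mp hAB
  obtain ⟨a, b, rfl⟩ := mem_unitBall_iff_exists.mp hBA
  have ha : a ≠ 0 := fun ha => hne (by simp [ha])
  have hb : b ≠ 0 := fun hb => hne (by rw [hb, vecMulVec_zero_right, add_zero])
  have hline (u : Fin n → F) : φ (A + vecMulVec a b + vecMulVec a u) - φ (A + vecMulVec a b) ∈
      rightSet p y ∩ leftSet q x := by
    refine ⟨?_, hB _ (mem_unitBall_iff_exists.mpr ⟨a, u, rfl⟩)⟩
    have hu : A + vecMulVec a b + vecMulVec a u ∈ unitBall A :=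
      mem_unitBall_iff_exists.mpr ⟨a, b + u, by rw [vecMulVec_add, add_assoc]⟩
    rw [← sub_sub_sub_cancel_right _ _ (φ A)]
    exact (rightSubmodule p y).sub_mem (hA _ hu) (hA _ hBA)
  obtain ⟨w, hbw⟩ := exists_linearIndependent_pair_of_one_lt_finrank (R := F) (by simpa using hn) hb
  exact hφ.not_linearIndependent_pair ha (fun c => hline _) (fun c => hline _) hbw

theorem MapsBallInto.right_of_adjacent (hφ : PreservesAdjacency φ) {y' : Fin q → F}
    (hA : MapsBallInto φ A (rightSet p y)) (hB : MapsBallInto φ B (rightSet p y'))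
    (hAB : Adjacent A B) : MapsBallInto φ B (rightSet p y) := by
  have hBA := (adjacent_iff_ne_and_mem_unitBall.mp hAB).2
  have hne := (adjacent_iff_ne_and_mem_unitBall.mp (hφ A B hAB)).1
  have hy : φ A - φ B ∈ rightSet p y :=
    (sub_mem_comm_iff (H := rightSubmodule p y)).mp (hA B hBA)
  have hy' : φ A - φ B ∈ rightSet p y' := hB A (mem_unitBall_comm.mp hBA)
  exact fun C hC => rightSet_subset_rightSet_of_mem (sub_ne_zero.mpr hne) hy hy' (hB C hC)

theorem IsDegenerateAdjacencyPreserver.mapsBallInto_right [Finite F] (hn : 1 < n)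
    (hφ : IsDegenerateAdjacencyPreserver φ) (hA : MapsBallInto φ A (rightSet p y))
    (B : Matrix (Fin m) (Fin n) F) : MapsBallInto φ B (rightSet p y) := by
  refine forall_of_unitBall (P := fun B => MapsBallInto φ B (rightSet p y)) ?_ hA B
  intro B hB C hC
  rcases eq_or_ne B C with rfl | hne
  · exact hB
  have hBC : Adjacent B C := adjacent_iff_ne_and_mem_unitBall.mpr ⟨hne, hC⟩
  obtain ⟨x', y', hC⟩ := (hφ.2 C).exists_mapsBallInto
  rcases hC.right_or_left hn hφ.1 with hR | hL
  · exact hB.right_of_adjacent hφ.1 hR hBC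
  · exact absurd hL (hB.not_left_of_adjacent hn hφ.1 hBC)

theorem IsDegenerateAdjacencyPreserver.isAdjacentSet_range_of_right [Finite F] (hn : 1 < n)
    (hφ : IsDegenerateAdjacencyPreserver φ) (hA : MapsBallInto φ A (rightSet p y)) :
    IsAdjacentSet (Set.range φ) := by
  have hrange (B) : φ B - φ A ∈ rightSubmodule p y := by
    refine forall_of_unitBall (P := fun B => φ B - φ A ∈ rightSubmodule p y) (fun B hB C hC => ?_)
      (by rw [sub_self]; exact zero_mem _) B
    rw [← sub_add_sub_cancel]
    exact add_mem (hφ.mapsBallInto_right hn hA B C hC) hB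
  have hsub : Set.range φ ⊆ Set.range fun v => φ A + vecMulVec v y := by
    rintro _ ⟨B, rfl⟩
    obtain ⟨v, hv⟩ := hrange B
    exact ⟨v, (sub_eq_iff_eq_add'.mp hv).symm⟩
  exact fun M hM N hN => isAdjacentSet_range_add_vecMulVec_left (φ A) y M (hsub hM) N (hsub hN)

theorem IsDegenerateAdjacencyPreserver.transpose (hφ : IsDegenerateAdjacencyPreserver φ) :
    IsDegenerateAdjacencyPreserver fun A => (φ A)ᵀ := by
  refine ⟨fun A B h => adjacent_transpose_iff.mpr (hφ.1 A B h), fun A => ?_⟩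
  obtain ⟨x, y, hx, hy, h⟩ := hφ.2 A
  refine ⟨y, x, hy, hx, ?_⟩
  rintro _ ⟨B, hB, rfl⟩
  rcases h ⟨B, hB, rfl⟩ with ⟨M, hM, hMB⟩ | ⟨M, hM, hMB⟩
  · exact Or.inr ⟨Mᵀ, transpose_mem_leftSet_iff.mpr hM, by simp [← hMB]⟩
  · exact Or.inl ⟨Mᵀ, transpose_mem_rightSet_iff.mpr hM, by simp [← hMB]⟩

theorem IsDegenerateAdjacencyPreserver.isAdjacentSet_range_of_left [Finite F] (hn : 1 < n)
    (hφ : IsDegenerateAdjacencyPreserver φ) (hA : MapsBallInto φ A (leftSet q x)) :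
    IsAdjacentSet (Set.range φ) := by
  have hAt : MapsBallInto (fun B => (φ B)ᵀ) A (rightSet q x) := fun B hB => by
    simpa only [← transpose_sub] using transpose_mem_rightSet_iff.mpr (hA B hB)
  rintro _ ⟨B, rfl⟩ _ ⟨C, rfl⟩ hne
  exact adjacent_transpose_iff.mp (hφ.transpose.isAdjacentSet_range_of_right hn hAt _ ⟨B, rfl⟩ _
    ⟨C, rfl⟩ (transpose_injective.ne hne))

theorem PreservesAdjacency.isAdjacentSet_range_of_width_le_one (hn : n ≤ 1)
    (hφ : PreservesAdjacency φ) : IsAdjacentSet (Set.range φ) := by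
  rintro _ ⟨A, rfl⟩ _ ⟨B, rfl⟩ hne
  exact hφ A B (adjacent_iff_ne_and_mem_unitBall.mpr
    ⟨fun h => hne (congrArg φ h), (rank_le_width _).trans hn⟩)

end

end MatrixGeometry

theorem theorem1p3 {F : Type*} [Field F] [Finite F] {m n p q : ℕ}
    (hm : 0 < m) (hn : 0 < n) (hp : 0 < p) (hq : 0 < q)
    (φ : Matrix (Fin m) (Fin n) F → Matrix (Fin p) (Fin q) F)
    (hφ : MatrixGeometry.IsDegenerateAdjacencyPreserver φ) :
    MatrixGeometry.IsAdjacentSet (Set.range φ) := by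
  rcases Nat.lt_or_ge 1 n with hn' | hn'
  · obtain ⟨x, y, h⟩ := (hφ.2 0).exists_mapsBallInto
    rcases h.right_or_left hn' hφ.1 with hR | hL
    · exact hφ.isAdjacentSet_range_of_right hn' hR
    · exact hφ.isAdjacentSet_range_of_left hn' hL
  · exact hφ.1.isAdjacentSet_range_of_width_le_one hn'
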